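/- Let $G=(V,E)$ be a finite weakly connected directed graph with $n=|V|$ nodes and at least one edge. For $v\in V$ let $N_{\mathrm{out}}(v)=\{u:(v,u)\in E\}$, $N_{\mathrm{in}}(v)=\{u:(u,v)\in E\}$ and $d_{\mathrm{sum}}(v)=|N_{\mathrm{out}}(v)|+|N_{\mathrm{in}}(v)|$, and for $u,v\in V$ let $m(v,u)=\mathbf 1_{u\in N_{\mathrm{out}}(v)}+\mathbf 1_{u\in N_{\mathrm{in}}(v)}$. Let $0\le\alpha<1$. Let $\{Z_s\}_{s\ge1}$ be a Markov chain, with any initial distribution, on the set $\Omega$ of all pairs $e_{ij}=(v_i,v_j)\in V\times V$ such that $(v_i,v_j)\in E$ or $(v_j,v_i)\in E$ or $v_i=v_j$ ($v_i$ is the staying node and $v_j$ the sampling node), with the following transitions: from $e_{ij}$ a node $v_k$ is drawn with probability $m(v_i,v_k)/d_{\mathrm{sum}}(v_i)$ and, independently, the next state is $e_{ik}$ with probability $\alpha$ (adjacent node sampling) and $e_{kk}$ with probability $1-\alpha$ (transition sampling). For any $f:V\to\mathbb R$ put $g(e_{ij})=f(v_j)$ and $w(e_{ij})=1/d_{\mathrm{sum}}(v_j)$.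 Then, as $t\to\infty$, $$\frac{\sum_{s=1}^t w(Z_s)\,g(Z_s)}{\sum_{s=1}^t w(Z_s)}\;\longrightarrow\;\frac1n\sum_{v\in V}f(v)\qquad\text{almost surely.}$$ -/

import Mathlib

open Filter Topology MeasureTheory

namespace NeighbourSampling

open Classical in
/-- The set of friends (out-neighbours) of `v`. -/
noncomputable def nOut {V : Type*} [Fintype V] (G : Digraph V) (v : V) : Finset V :=
  Finset.univ.filter fun u => G.Adj v u

open Classical in
/-- The set of followers (in-neighbours) of `v`. -/
noncomputable def nIn {V : Type*} [Fintype V] (G : Digraph V) (v : V) : Finset V :=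
  Finset.univ.filter fun u => G.Adj u v

/-- The total degree: in-degree plus out-degree. -/
noncomputable def dSum {V : Type*} [Fintype V] (G : Digraph V) (v : V) : ℕ :=
  (nIn G v).card + (nOut G v).card

/-- The state space: pairs (staying node, sampling node) which are joined by an edge in one of the
two directions, or equal. -/
abbrev State {V : Type*} (G : Digraph V) : Type _ :=
  {e : V × V // (G.Adj e.1 e.2 ∨ G.Adj e.2 e.1) ∨ e.1 = e.2}

open Classical in
/-- The multiplicity of `u` in the list that concatenates the friends and the followers of `v`. -/
noncomputable def mult {V : Type*} [Fintype V] (G : Digraph V) (v u : V) : ℕ :=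
  (if u ∈ nOut G v then 1 else 0) + (if u ∈ nIn G v then 1 else 0)

/-- The probability of staying at `v` and sampling its neighbour `u`. -/
noncomputable def pNeighbor {V : Type*} [Fintype V] (G : Digraph V) (α : ℝ) (u v : V) : ℝ :=
  α * ((mult G v u : ℝ) / (dSum G v : ℝ))

/-- The probability of moving from `v` to its neighbour `u` (and sampling `u`). -/
noncomputable def pWalk {V : Type*} [Fintype V] (G : Digraph V) (α : ℝ) (u v : V) : ℝ :=
  (1 - α) * ((mult G v u : ℝ) / (dSum G v : ℝ))

open Classical in
/-- The transition matrix of the chain of pairs (staying node, sampling node): from `(i, j)` to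
`(i, k)` by adjacent node sampling, and from `(i, j)` to `(k, k)` by transition sampling. The two
kinds of step can lead to the same state only if `i` carries a loop; their probabilities are then
added. See `transitionMatrix_eq_cases` for the form by cases in a graph without loops. -/
noncomputable def transitionMatrix {V : Type*} [Fintype V] (G : Digraph V) (α : ℝ) :
    Matrix (State G) (State G) ℝ := fun e e' =>
  (if e.1.1 = e'.1.1 then pNeighbor G α e'.1.2 e.1.1 else 0) +
    (if e'.1.1 = e'.1.2 then pWalk G α e'.1.2 e.1.1 else 0)

open Classical in
theorem transitionMatrix_eq_cases {V : Type*} [Fintype V] (G : Digraph V)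
    (hG : ∀ v, ¬ G.Adj v v) (α : ℝ) (e e' : State G) :
    transitionMatrix G α e e' =
      if e.1.1 = e'.1.1 then pNeighbor G α e'.1.2 e.1.1
      else if e'.1.1 = e'.1.2 ∧ e'.1.1 ∈ nOut G e.1.1 ∪ nIn G e.1.1 then
        pWalk G α e'.1.2 e.1.1
      else 0 := by
  obtain ⟨⟨i, j⟩, h⟩ := e
  obtain ⟨⟨l, k⟩, h'⟩ := e'
  by_cases h1 : i = l
  · subst h1
    by_cases h2 : i = k
    · subst h2
      simp [transitionMatrix, pWalk, mult, nOut, nIn, hG]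
    · simp [transitionMatrix, h2]
  · by_cases h2 : l = k
    · subst h2
      by_cases h3 : G.Adj i l <;> by_cases h4 : G.Adj l i <;>
        simp [transitionMatrix, h1, pWalk, mult, nOut, nIn, h3, h4]
    · simp [transitionMatrix, h1, h2]

/-- The random sequence `Z 0, Z 1, …` with values in a finite set `S` is a time-homogeneous Markov
chain with transition matrix `P` (and arbitrary initial distribution): given a history
`Z 0 = x 0, …, Z n = x n`, the probability of `Z (n + 1) = x (n + 1)` is `P (x n) (x (n + 1))`.
Conditional probabilities are multiplied out. -/
structure IsMarkovChain {Ω S : Type*} [MeasurableSpace Ω] (μ : Measure Ω) (P : Matrix S S ℝ)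
    (Z : ℕ → Ω → S) : Prop where
  measurableSet_eq : ∀ (n : ℕ) (x : S), MeasurableSet {ω | Z n ω = x}
  markov : ∀ (n : ℕ) (x : ℕ → S),
    μ.real {ω | ∀ i ≤ n + 1, Z i ω = x i} =
      μ.real {ω | ∀ i ≤ n, Z i ω = x i} * P (x n) (x (n + 1))

/-- The feature of the sampling node of a state. -/
def feature {V : Type*} (G : Digraph V) (f : V → ℝ) (e : State G) : ℝ := f e.1.2

/-- The weight of a state: the inverse total degree of its sampling node. -/
noncomputable def weight {V : Type*} [Fintype V] (G : Digraph V) (e : State G) : ℝ :=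
  1 / (dSum G e.1.2 : ℝ)

/-- The average of `f` over the nodes. -/
noncomputable def uniformAverage {V : Type*} [Fintype V] (f : V → ℝ) : ℝ :=
  1 / (Fintype.card V : ℝ) * ∑ v, f v

end NeighbourSampling

/-! ### Strong law for finite Markov chains via Poisson's equation -/

namespace NeighbourSampling

/-! Write m, d for `mult`, `dSum`, P for the transition matrix. Let h be a function of the sampling
node and c its d-weighted mean. If φ - Pφ = h - c, the sum of h - c along the chain is a martingale
with bounded increments plus a bounded telescoping term. The martingale has second moment O(n), so
divided by n it tends to 0 almost surely (`IsMarkovChain.ae_tendsto_average`). Poisson's equation is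
solved explicitly: φ(v,j) = h(j) + x(v)/(1-α) turns it into Lx(v) = ∑ m(v,u)h(u) - c d(v), with L
the weighted Laplacian. Connectedness makes every right side of sum zero attainable
(`exists_laplacian_eq`). Neither irreducibility nor aperiodicity of the chain is needed. Taking h =
f/d and h = 1/d gives the limits ∑f/∑d and n/∑d, whose quotient is the uniform average. -/

theorem tendsto_div_of_tendsto_div_sq {S : ℕ → ℝ} {C : ℝ}
    (hS : ∀ n, |S (n + 1) - S n| ≤ C)
    (hsq : Tendsto (fun k : ℕ => S (k ^ 2) / (k : ℝ) ^ 2) atTop (𝓝 0)) :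
    Tendsto (fun n : ℕ => S n / n) atTop (𝓝 0) := by
  have hC : 0 ≤ C := (abs_nonneg _).trans (hS 0)
  have hdiff : ∀ m d : ℕ, |S (m + d) - S m| ≤ C * d := by
    intro m d
    induction d with
    | zero => simp
    | succ d ih =>
      have h1 := hS (m + d)
      have h2 := abs_sub_le (S (m + d + 1)) (S (m + d)) (S m)
      rw [← add_assoc]
      push_cast
      linarith
  have hsqrt : Tendsto Nat.sqrt atTop atTop := by
    refine tendsto_atTop_atTop.2 fun b => ⟨b ^ 2, fun a ha => ?_⟩
    exact Nat.le_sqrt'.2 ha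
  have hbound : Tendsto (fun k : ℕ => |S (k ^ 2) / (k : ℝ) ^ 2| + 2 * C * (1 / (k : ℝ)))
      atTop (𝓝 0) := by
    simpa using hsq.abs.add (tendsto_one_div_atTop_nhds_zero_nat.const_mul (2 * C))
  refine squeeze_zero_norm' ?_ (hbound.comp hsqrt)
  filter_upwards [eventually_ge_atTop 1] with n hn
  -- With k = ⌊√n⌋, n exceeds k² by at most 2k, so filling the gap costs at most 2kC, which is
  -- negligible against k².
  have hk : 0 < Nat.sqrt n := Nat.sqrt_pos.2 hn
  have hle : Nat.sqrt n ^ 2 ≤ n := Nat.sqrt_le' n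
  have hlt : n ≤ Nat.sqrt n ^ 2 + 2 * Nat.sqrt n := by
    have := Nat.sqrt_le_add n
    nlinarith
  simp only [Function.comp_apply]
  generalize Nat.sqrt n = k at *
  obtain ⟨d, rfl⟩ := Nat.exists_eq_add_of_le hle
  have hd : d ≤ 2 * k := by omega
  have hdR : (d : ℝ) ≤ 2 * k := by exact_mod_cast hd
  have hkR : (0 : ℝ) < k := by exact_mod_cast hk
  have hnR : ((k ^ 2 + d : ℕ) : ℝ) = (k : ℝ) ^ 2 + d := by push_cast; ring
  have habs : |S (k ^ 2 + d)| ≤ |S (k ^ 2)| + C * (2 * k) := by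
    have h1 := abs_sub_abs_le_abs_sub (S (k ^ 2 + d)) (S (k ^ 2))
    have h2 := hdiff (k ^ 2) d
    have h3 := mul_le_mul_of_nonneg_left hdR hC
    linarith
  rw [Real.norm_eq_abs, abs_div, abs_div, hnR, abs_of_pos (by positivity : 0 < (k : ℝ) ^ 2 + d),
    abs_of_pos (by positivity : 0 < (k : ℝ) ^ 2)]
  calc |S (k ^ 2 + d)| / ((k : ℝ) ^ 2 + d)
      ≤ (|S (k ^ 2)| + C * (2 * k)) / (k : ℝ) ^ 2 := by
        gcongr
        linarith [(Nat.cast_nonneg d : (0 : ℝ) ≤ d)]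
    _ = _ := by field_simp

/-- Along n = k² the second moments of S n / n are at most K/k², hence summable; so the sum of the
squares is almost surely finite and its terms tend to 0. -/
theorem ae_tendsto_div_of_integral_sq_le {Ω : Type*} [MeasurableSpace Ω] {μ : Measure Ω}
    [IsFiniteMeasure μ] {S : ℕ → Ω → ℝ} {C K : ℝ} (hmeas : ∀ n, Measurable (S n))
    (hint : ∀ n, Integrable (fun ω => S n ω ^ 2) μ)
    (hS : ∀ n ω, |S (n + 1) ω - S n ω| ≤ C)
    (hvar : ∀ n : ℕ, ∫ ω, S n ω ^ 2 ∂μ ≤ K * n) :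
    ∀ᵐ ω ∂μ, Tendsto (fun n : ℕ => S n ω / n) atTop (𝓝 0) := by
  let X : ℕ → Ω → ℝ := fun k ω => (S (k ^ 2) ω / (k : ℝ) ^ 2) ^ 2
  have hXint : ∀ k, Integrable (X k) μ := fun k => by
    simp only [X, div_pow]
    exact (hint _).div_const _
  have hXle : ∀ k : ℕ, ∫ ω, X k ω ∂μ ≤ K * (1 / (k : ℝ) ^ 2) := by
    intro k
    simp only [X, div_pow, integral_div]
    rcases Nat.eq_zero_or_pos k with rfl | hk
    · simp
    · have hkR : (0 : ℝ) < k := by exact_mod_cast hk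
      have := hvar (k ^ 2)
      push_cast at this
      rw [div_le_iff₀ (by positivity)]
      calc _ ≤ _ := this
        _ = _ := by field_simp
  have hsum : Summable fun k => ∫ ω, X k ω ∂μ :=
    Summable.of_nonneg_of_le (fun k => integral_nonneg fun ω => sq_nonneg _) hXle
      ((Real.summable_one_div_nat_pow.2 one_lt_two).mul_left K)
  have hlin : ∑' k, ∫⁻ ω, ENNReal.ofReal (X k ω) ∂μ ≠ ⊤ := by
    have : ∀ k, ∫⁻ ω, ENNReal.ofReal (X k ω) ∂μ = ENNReal.ofReal (∫ ω, X k ω ∂μ) := fun k =>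
      (ofReal_integral_eq_lintegral_ofReal (hXint k) (ae_of_all _ fun ω => sq_nonneg _)).symm
    simp_rw [this]
    exact hsum.tsum_ofReal_ne_top
  have hXmeas : ∀ k, Measurable fun ω => ENNReal.ofReal (X k ω) := fun k =>
    ((((hmeas _).div_const _).pow_const 2)).ennreal_ofReal
  rw [← lintegral_tsum fun k => (hXmeas k).aemeasurable] at hlin
  filter_upwards [ae_lt_top (Measurable.tsum hXmeas) hlin] with ω hω
  refine tendsto_div_of_tendsto_div_sq (fun n => hS n ω) ?_
  have h0 := ENNReal.tendsto_atTop_zero_of_tsum_ne_top hω.ne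
  have h1 : Tendsto (fun k => X k ω) atTop (𝓝 0) := by
    have := (ENNReal.tendsto_toReal ENNReal.zero_ne_top).comp h0
    refine this.congr fun k => ?_
    simp [X, ENNReal.toReal_ofReal (sq_nonneg _)]
  have h2 := (Real.continuous_sqrt.tendsto 0).comp h1
  simp only [Real.sqrt_zero] at h2
  refine (tendsto_zero_iff_abs_tendsto_zero _).2 (h2.congr fun k => ?_)
  simp [X, Real.sqrt_sq_eq_abs]

variable {Ω S : Type*} [MeasurableSpace Ω] {μ : Measure Ω} {P : Matrix S S ℝ} {Z : ℕ → Ω → S}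

theorem IsMarkovChain.measurable [Finite S] [MeasurableSpace S] (hZ : IsMarkovChain μ P Z)
    (n : ℕ) : Measurable (Z n) :=
  measurable_to_countable' fun x => hZ.measurableSet_eq n x

/-- The trajectory up to time `n`. -/
def history (Z : ℕ → Ω → S) (n : ℕ) (ω : Ω) : Fin (n + 1) → S := fun i => Z i ω

theorem IsMarkovChain.measureReal_history_snoc (hZ : IsMarkovChain μ P Z) (n : ℕ)
    (x : Fin (n + 1) → S) (y : S) :
    μ.real {ω | history Z (n + 1) ω = Fin.snoc x y} =
      μ.real {ω | history Z n ω = x} * P (x (Fin.last n)) y := by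
  -- Only the value at n + 1 matters among the indices filled with y.
  let x' : ℕ → S := fun i => if h : i < n + 1 then x ⟨i, h⟩ else y
  have hx' : ∀ (i : ℕ) (h : i < n + 1), x' i = x ⟨i, h⟩ := fun i h => dif_pos h
  have h1 : {ω | history Z (n + 1) ω = Fin.snoc (α := fun _ => S) x y} =
      {ω | ∀ i ≤ n + 1, Z i ω = x' i} := by
    ext ω
    simp only [Set.mem_ofPred_eq, funext_iff, history]
    constructor
    · intro h i hi
      exact h ⟨i, by omega⟩
    · intro h i
      exact h i (by omega)
  have h2 : {ω | history Z n ω = x} = {ω | ∀ i ≤ n, Z i ω = x' i} := by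
    ext ω
    simp only [Set.mem_ofPred_eq, funext_iff, history]
    constructor
    · intro h i hi
      rw [hx' i (by omega)]
      exact h ⟨i, by omega⟩
    · intro h i
      rw [← hx' i i.2]
      exact h i (by omega)
  rw [h1, h2, hZ.markov n x']
  simp [x', Fin.last]

theorem IsMarkovChain.integral_history [Fintype S] [IsFiniteMeasure μ]
    (hZ : IsMarkovChain μ P Z) (n : ℕ) (F : (Fin (n + 1) → S) → ℝ) :
    ∫ ω, F (history Z n ω) ∂μ = ∑ x, μ.real {ω | history Z n ω = x} * F x := by
  classical
  let _ : MeasurableSpace S := ⊤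
  have hm : Measurable (history Z n) := measurable_pi_lambda _ fun i => hZ.measurable i
  rw [← integral_map (φ := history Z n) (f := F) hm.aemeasurable
    (measurable_of_finite F).aestronglyMeasurable, integral_fintype .of_finite]
  refine Finset.sum_congr rfl fun x _ => ?_
  rw [map_measureReal_apply hm (measurableSet_singleton x)]
  rfl

/-- Orthogonality of a martingale increment to the past: for each fixed history, the sum over the
next state vanishes because the row of P sums to 1. -/
theorem IsMarkovChain.integral_mul_increment_eq_zero [Fintype S] [IsFiniteMeasure μ]
    (hZ : IsMarkovChain μ P Z) (hP : ∀ e, ∑ e', P e e' = 1) (φ : S → ℝ) (n : ℕ)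
    (F : (Fin (n + 1) → S) → ℝ) :
    ∫ ω, F (history Z n ω) * (φ (Z (n + 1) ω) - ∑ e, P (Z n ω) e * φ e) ∂μ = 0 := by
  let F' : (Fin (n + 2) → S) → ℝ := fun x =>
    F (Fin.init x) * (φ (x (Fin.last (n + 1))) -
      ∑ e, P ((Fin.init x : Fin (n + 1) → S) (Fin.last n)) e * φ e)
  calc _ = ∫ ω, F' (history Z (n + 1) ω) ∂μ := rfl
    _ = 0 := ?_
  rw [hZ.integral_history (n + 1) F',
    ← (Fin.snocEquiv fun _ : Fin (n + 2) => S).sum_comp, Fintype.sum_prod_type_right]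
  refine Finset.sum_eq_zero fun x _ => ?_
  have hterm : ∀ y : S, μ.real {ω | history Z (n + 1) ω = Fin.snoc (α := fun _ => S) x y} *
      F' (Fin.snoc (α := fun _ => S) x y) = μ.real {ω | history Z n ω = x} * F x *
        (P (x (Fin.last n)) y * φ y -
          P (x (Fin.last n)) y * ∑ e, P (x (Fin.last n)) e * φ e) := by
    intro y
    rw [hZ.measureReal_history_snoc]
    simp only [F', Fin.init_snoc, Fin.snoc_last]
    ring
  refine (Finset.sum_congr rfl fun y _ => hterm y).trans ?_
  rw [← Finset.mul_sum, Finset.sum_sub_distrib, ← Finset.sum_mul, hP]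
  ring

/-- The strong law of large numbers for a finite Markov chain and a function `g` for which
Poisson's equation `φ - P φ = g - c` has a solution `φ`. -/
theorem IsMarkovChain.ae_tendsto_average [Fintype S] [IsProbabilityMeasure μ]
    (hZ : IsMarkovChain μ P Z) (hP : ∀ e, ∑ e', P e e' = 1) {φ g : S → ℝ} {c : ℝ}
    (hφ : ∀ e, φ e - ∑ e', P e e' * φ e' = g e - c) :
    ∀ᵐ ω ∂μ, Tendsto (fun t : ℕ => (∑ s ∈ Finset.range t, g (Z s ω)) / t) atTop (𝓝 c) := by
  let _ : MeasurableSpace S := ⊤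
  obtain ⟨C, hC⟩ : ∃ C, ∀ p : S × S, |φ p.2 - ∑ e, P p.1 e * φ e| ≤ C := by
    obtain ⟨C, hC⟩ := (Set.finite_range
      fun p : S × S => |φ p.2 - ∑ e, P p.1 e * φ e|).bddAbove
    exact ⟨C, fun p => hC ⟨p, rfl⟩⟩
  obtain ⟨B, hB⟩ : ∃ B, ∀ e, |φ e| ≤ B := by
    obtain ⟨B, hB⟩ := (Set.finite_range fun e : S => |φ e|).bddAbove
    exact ⟨B, fun p => hB ⟨p, rfl⟩⟩
  let D : ℕ → Ω → ℝ := fun s ω => φ (Z (s + 1) ω) - ∑ e, P (Z s ω) e * φ e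
  let M : ℕ → Ω → ℝ := fun n ω => ∑ s ∈ Finset.range n, D s ω
  have hDC : ∀ s ω, |D s ω| ≤ C := fun s ω => hC (Z s ω, Z (s + 1) ω)
  have hDm : ∀ s, Measurable (D s) := fun s =>
    ((measurable_of_finite φ).comp (hZ.measurable (s + 1))).sub
      ((measurable_of_finite fun x => ∑ e, P x e * φ e).comp (hZ.measurable s))
  have hMm : ∀ n, Measurable (M n) := fun n => Finset.measurable_fun_sum _ fun s _ => hDm s
  have hMC : ∀ n ω, |M n ω| ≤ n * C := fun n ω => by
    refine (Finset.abs_sum_le_sum_abs _ _).trans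
      ((Finset.sum_le_card_nsmul _ _ C fun s _ => hDC s ω).trans ?_)
    simp
  have hint : ∀ {X Y : Ω → ℝ} {a b : ℝ}, Measurable X → Measurable Y → (∀ ω, |X ω| ≤ a) →
      (∀ ω, |Y ω| ≤ b) → Integrable (fun ω => X ω * Y ω) μ := by
    intro X Y a b hX hY ha hb
    refine Integrable.of_bound (hX.mul hY).aestronglyMeasurable (a * b) (ae_of_all _ fun ω => ?_)
    rw [Real.norm_eq_abs, abs_mul]
    exact mul_le_mul (ha ω) (hb ω) (abs_nonneg _) ((abs_nonneg _).trans (ha ω))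
  have hMsucc : ∀ n ω, M (n + 1) ω = M n ω + D n ω := fun n ω => Finset.sum_range_succ _ _
  have hMint : ∀ n, Integrable (fun ω => M n ω ^ 2) μ := fun n => by
    simpa only [sq] using hint (hMm n) (hMm n) (hMC n) (hMC n)
  have hDint : ∀ n, Integrable (fun ω => D n ω ^ 2) μ := fun n => by
    simpa only [sq] using hint (hDm n) (hDm n) (hDC n) (hDC n)
  -- M n is a function of the trajectory up to time n.
  have horth : ∀ n, ∫ ω, M n ω * D n ω ∂μ = 0 := fun n => by
    rw [← hZ.integral_mul_increment_eq_zero hP φ n fun x =>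
      ∑ s : Fin n, (φ (x s.succ) - ∑ e, P (x s.castSucc) e * φ e)]
    refine integral_congr_ae (ae_of_all _ fun ω => ?_)
    simp only [M, D, history, Fin.val_succ, Fin.val_castSucc]
    rw [← Fin.sum_univ_eq_sum_range
      (fun s => φ (Z (s + 1) ω) - ∑ e, P (Z s ω) e * φ e)]
  have hvar : ∀ n : ℕ, ∫ ω, M n ω ^ 2 ∂μ ≤ C ^ 2 * n := by
    intro n
    induction n with
    | zero => simp [M]
    | succ n ih =>
      have hexp : ∀ ω, M (n + 1) ω ^ 2 = M n ω ^ 2 + 2 * (M n ω * D n ω) + D n ω ^ 2 :=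
        fun ω => by rw [hMsucc]; ring
      have hMD := (hint (hMm n) (hDm n) (hMC n) (hDC n)).const_mul 2
      have hD2 : ∫ ω, D n ω ^ 2 ∂μ ≤ C ^ 2 := by
        refine (integral_mono (hDint n) (integrable_const (C ^ 2)) fun ω => ?_).trans (by simp)
        exact sq_le_sq.2 ((hDC n ω).trans (le_abs_self C))
      simp_rw [hexp]
      rw [integral_add (f := fun ω => M n ω ^ 2 + 2 * (M n ω * D n ω)) ((hMint n).add hMD) (hDint n),
        integral_add (hMint n) hMD,
        integral_const_mul, horth]
      push_cast
      linarith
  have hlim := ae_tendsto_div_of_integral_sq_le hMm hMint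
    (fun n ω => by rw [hMsucc, add_sub_cancel_left]; exact hDC n ω) hvar
  filter_upwards [hlim] with ω hω
  have htel : ∀ t, ∑ s ∈ Finset.range t, g (Z s ω) =
      M t ω + t * c + (φ (Z 0 ω) - φ (Z t ω)) := by
    intro t
    induction t with
    | zero => simp [M]
    | succ t ih =>
      have h1 := hφ (Z t ω)
      rw [Finset.sum_range_succ, ih, hMsucc]
      simp only [D]
      push_cast
      linarith
  have hbdry : Tendsto (fun t : ℕ => (φ (Z 0 ω) - φ (Z t ω)) / t) atTop (𝓝 0) := by
    have h0 : Tendsto (fun t : ℕ => 2 * B * (1 / (t : ℝ))) atTop (𝓝 0) := by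
      simpa using tendsto_one_div_atTop_nhds_zero_nat.const_mul (2 * B)
    refine squeeze_zero_norm (fun t => ?_) h0
    rw [Real.norm_eq_abs, abs_div, Nat.abs_cast, mul_one_div]
    gcongr
    linarith [abs_sub (φ (Z 0 ω)) (φ (Z t ω)), hB (Z 0 ω), hB (Z t ω)]
  have hfin : Tendsto (fun t : ℕ => M t ω / t + c + (φ (Z 0 ω) - φ (Z t ω)) / t) atTop (𝓝 c) := by
    simpa using (hω.add_const c).add hbdry
  refine hfin.congr' ?_
  filter_upwards [eventually_ge_atTop 1] with t ht
  have : (t : ℝ) ≠ 0 := by positivity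
  rw [htel]
  field_simp

end NeighbourSampling

namespace NeighbourSampling

/-! ### The Laplacian of the underlying weighted graph -/

variable {V : Type*} [Fintype V] (G : Digraph V)

theorem mult_comm (u v : V) : mult G u v = mult G v u := by
  by_cases h : G.Adj u v <;> by_cases h' : G.Adj v u <;> simp [mult, nOut, nIn, h, h']

theorem mult_pos {u v : V} (h : G.Adj u v ∨ G.Adj v u) : 0 < mult G u v := by
  rcases h with h | h <;> simp [mult, nOut, nIn, h]

theorem mult_eq_zero {u v : V} (h : ¬(G.Adj u v ∨ G.Adj v u)) : mult G u v = 0 := by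
  rw [not_or] at h
  simp [mult, nOut, nIn, h.1, h.2]

theorem sum_mult (v : V) : ∑ u, mult G v u = dSum G v := by
  classical
  simp only [mult, dSum, Finset.sum_add_distrib, Finset.sum_boole, Nat.cast_id,
    Finset.filter_univ_mem]
  exact add_comm _ _

theorem sum_mult_cast (v : V) : ∑ u, (mult G v u : ℝ) = dSum G v := by
  exact_mod_cast sum_mult G v

theorem dSum_pos (hconn : G.toSimpleGraphInclusive.Connected) (hE : ∃ u v, G.Adj u v) (v : V) :
    0 < dSum G v := by
  have key : ∀ {u : V}, (G.Adj v u ∨ G.Adj u v) → 0 < dSum G v := fun {u} h => by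
    rw [← sum_mult]
    exact (mult_pos G h).trans_le
      (Finset.single_le_sum (f := fun u => mult G v u) (fun _ _ => Nat.zero_le _)
        (Finset.mem_univ u))
  obtain ⟨a, b, hab⟩ := hE
  -- The simple graph forgets loops; if V has one node, the given edge is a loop and falls under
  -- this first case.
  by_cases hva : v = a
  · subst hva
    exact key (Or.inl hab)
  · have : Nontrivial V := ⟨v, a, hva⟩
    obtain ⟨u, hu⟩ := hconn.preconnected.exists_adj_of_nontrivial v
    exact key (by simpa [Digraph.toSimpleGraphInclusive] using hu.2)

/-- The Laplacian of the weighted graph with edge weights `mult G`. -/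
noncomputable def laplacian : (V → ℝ) →ₗ[ℝ] (V → ℝ) where
  toFun x v := ∑ u, (mult G v u : ℝ) * (x v - x u)
  map_add' x y := by
    ext v
    simp only [Pi.add_apply, ← Finset.sum_add_distrib]
    exact Finset.sum_congr rfl fun u _ => by ring
  map_smul' a x := by
    ext v
    simp only [Pi.smul_apply, smul_eq_mul, RingHom.id_apply, Finset.mul_sum]
    exact Finset.sum_congr rfl fun u _ => by ring

theorem laplacian_apply (x : V → ℝ) (v : V) :
    laplacian G x v = ∑ u, (mult G v u : ℝ) * (x v - x u) := rfl

theorem sum_laplacian (x : V → ℝ) : ∑ v, laplacian G x v = 0 := by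
  have h : ∑ v, laplacian G x v = -∑ v, laplacian G x v := by
    simp only [laplacian_apply]
    conv_rhs => rw [Finset.sum_comm]
    simp only [← Finset.sum_neg_distrib]
    refine Finset.sum_congr rfl fun v _ => Finset.sum_congr rfl fun u _ => ?_
    rw [mult_comm G u v]
    ring
  linarith

theorem sum_mult_mul_sq (x : V → ℝ) :
    ∑ v, ∑ u, (mult G v u : ℝ) * (x v - x u) ^ 2 = 2 * ∑ v, x v * laplacian G x v := by
  have h : ∑ v, x v * laplacian G x v = ∑ v, ∑ u, (mult G v u : ℝ) * (x v - x u) * x v := by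
    refine Finset.sum_congr rfl fun v _ => ?_
    rw [laplacian_apply, mul_comm, Finset.sum_mul]
  have h' : ∑ v, x v * laplacian G x v = ∑ v, ∑ u, -((mult G v u : ℝ) * (x v - x u) * x u) := by
    rw [h, Finset.sum_comm]
    refine Finset.sum_congr rfl fun v _ => Finset.sum_congr rfl fun u _ => ?_
    rw [mult_comm G u v]
    ring
  rw [two_mul]
  nth_rewrite 1 [h]
  rw [h']
  simp only [← Finset.sum_add_distrib]
  exact Finset.sum_congr rfl fun v _ => Finset.sum_congr rfl fun u _ => by ring

variable {G}

/-- The Dirichlet energy of x vanishes, so x agrees across every edge, hence along walks. -/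
theorem eq_of_laplacian_eq_zero (hconn : G.toSimpleGraphInclusive.Connected) {x : V → ℝ}
    (hx : laplacian G x = 0) (u v : V) : x u = x v := by
  have h0 : ∑ v, ∑ u, (mult G v u : ℝ) * (x v - x u) ^ 2 = 0 := by
    rw [sum_mult_mul_sq, hx]
    simp
  have hadj : ∀ a b, G.toSimpleGraphInclusive.Adj a b → x a = x b := by
    intro a b hab
    have h1 := (Finset.sum_eq_zero_iff_of_nonneg fun v _ =>
      Finset.sum_nonneg fun u _ => by positivity).1 h0 a (Finset.mem_univ a)
    have h2 := (Finset.sum_eq_zero_iff_of_nonneg fun u _ => by positivity).1 h1 b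
      (Finset.mem_univ b)
    have hm : (mult G a b : ℝ) ≠ 0 := by
      have := mult_pos G (u := a) (v := b) (by simpa [Digraph.toSimpleGraphInclusive] using hab.2)
      positivity
    have h3 := (mul_eq_zero.1 h2).resolve_left hm
    exact sub_eq_zero.1 (pow_eq_zero_iff two_ne_zero |>.1 h3)
  obtain ⟨w⟩ := hconn.preconnected u v
  induction w with
  | nil => rfl
  | cons h _ ih => exact (hadj _ _ h).trans ih

theorem exists_laplacian_eq (hconn : G.toSimpleGraphInclusive.Connected) {y : V → ℝ}
    (hy : ∑ v, y v = 0) : ∃ x, laplacian G x = y := by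
  have := hconn.nonempty
  have hcard : (Fintype.card V : ℝ) ≠ 0 := by exact_mod_cast Fintype.card_ne_zero
  -- A rank-one correction makes the Laplacian injective, hence bijective; it vanishes on the
  -- preimage of any y of sum zero, since Laplacians sum to zero.
  let T : (V → ℝ) →ₗ[ℝ] (V → ℝ) :=
    laplacian G + LinearMap.pi fun _ => ∑ u, LinearMap.proj u
  have hT : ∀ x v, T x v = laplacian G x v + ∑ u, x u := fun x v => by simp [T]
  have hsum : ∀ x, ∑ v, T x v = Fintype.card V * ∑ u, x u := fun x => by
    simp [hT, Finset.sum_add_distrib, sum_laplacian]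
  have hzero : ∀ x, ∑ v, T x v = 0 → ∑ u, x u = 0 ∧ T x = laplacian G x := by
    intro x hx
    have h : ∑ u, x u = 0 := by
      rw [hsum] at hx
      exact (mul_eq_zero.1 hx).resolve_left hcard
    exact ⟨h, funext fun v => by rw [hT, h, add_zero]⟩
  have hinj : Function.Injective T := by
    refine (injective_iff_map_eq_zero T).2 fun x hx => ?_
    obtain ⟨h1, h2⟩ := hzero x (by simp [hx])
    have hc := eq_of_laplacian_eq_zero hconn (h2.symm.trans hx)
    funext v
    have : ∑ u, x u = Fintype.card V * x v := by
      simp [Finset.sum_congr rfl fun u _ => hc u v]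
    rw [h1] at this
    exact (mul_eq_zero.1 this.symm).resolve_left hcard
  obtain ⟨x, hx⟩ := LinearMap.injective_iff_surjective.1 hinj y
  exact ⟨x, (hzero x (by rw [hx, hy])).2.symm.trans hx⟩

/-! ### Poisson's equation for the sampling chain -/

theorem sum_state [Fintype (State G)] (T : V × V → ℝ)
    (hT : ∀ v u, ¬((G.Adj v u ∨ G.Adj u v) ∨ v = u) → T (v, u) = 0) :
    ∑ e : State G, T e.1 = ∑ v, ∑ u, T (v, u) := by
  classical
  rw [← Fintype.sum_prod_type', ← Finset.sum_subset (Finset.subset_univ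
    (Finset.univ.filter fun e : V × V => (G.Adj e.1 e.2 ∨ G.Adj e.2 e.1) ∨ e.1 = e.2))
    fun p _ hp => hT p.1 p.2 (by simpa using hp)]
  exact (Finset.sum_subtype _ (fun p => by simp) T).symm

theorem sum_transitionMatrix_mul [Fintype (State G)] (α : ℝ) (e : State G) (F : V → V → ℝ) :
    ∑ e' : State G, transitionMatrix G α e e' * F e'.1.1 e'.1.2 =
      ∑ k, (mult G e.1.1 k : ℝ) / dSum G e.1.1 * (α * F e.1.1 k + (1 - α) * F k k) := by
  classical
  have hsplit : ∀ e' : State G, transitionMatrix G α e e' * F e'.1.1 e'.1.2 =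
      (fun p : V × V => if e.1.1 = p.1 then pNeighbor G α p.2 e.1.1 * F p.1 p.2 else 0) e'.1 +
      (fun p : V × V => if p.1 = p.2 then pWalk G α p.2 e.1.1 * F p.1 p.2 else 0) e'.1 := by
    intro e'
    simp only [transitionMatrix, add_mul, ite_mul, zero_mul]
  rw [Finset.sum_congr rfl fun e' _ => hsplit e', Finset.sum_add_distrib,
    sum_state fun p : V × V => if e.1.1 = p.1 then pNeighbor G α p.2 e.1.1 * F p.1 p.2 else 0,
    sum_state fun p : V × V => if p.1 = p.2 then pWalk G α p.2 e.1.1 * F p.1 p.2 else 0]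
  · rw [Finset.sum_comm]
    simp only [Finset.sum_ite_eq, Finset.mem_univ, if_true, ← Finset.sum_add_distrib]
    refine Finset.sum_congr rfl fun k _ => ?_
    simp only [pNeighbor, pWalk]
    ring
  · intro v u h
    exact if_neg fun h' => h (Or.inr h')
  · intro v u h
    refine ite_eq_right_iff.2 fun h' => ?_
    subst h'
    rw [pNeighbor, mult_eq_zero G fun hadj => h (Or.inl hadj)]
    simp

theorem sum_transitionMatrix [Fintype (State G)] (α : ℝ) (e : State G) (hd : dSum G e.1.1 ≠ 0) :
    ∑ e' : State G, transitionMatrix G α e e' = 1 := by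
  have h := sum_transitionMatrix_mul α e fun _ _ => 1
  have hd' : (dSum G e.1.1 : ℝ) ≠ 0 := by exact_mod_cast hd
  simp only [mul_one, add_sub_cancel, ← Finset.sum_div, sum_mult_cast, div_self hd'] at h
  exact h

theorem sum_dSum_pos (hconn : G.toSimpleGraphInclusive.Connected) (hE : ∃ u v, G.Adj u v) :
    0 < ∑ v, (dSum G v : ℝ) := by
  have := hconn.nonempty
  exact Finset.sum_pos (fun v _ => by exact_mod_cast dSum_pos G hconn hE v)
    Finset.univ_nonempty

/-- Poisson's equation for a function of the sampling node. -/
theorem exists_poisson_solution [Fintype (State G)] (hconn : G.toSimpleGraphInclusive.Connected)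
    (hE : ∃ u v, G.Adj u v) {α : ℝ} (hα : α < 1) (h : V → ℝ) :
    ∃ φ : State G → ℝ, ∀ e, φ e - ∑ e' : State G, transitionMatrix G α e e' * φ e' =
      h e.1.2 - (∑ v, dSum G v * h v) / ∑ v, (dSum G v : ℝ) := by
  have hD := sum_dSum_pos hconn hE
  set D := ∑ v, (dSum G v : ℝ)
  set c := (∑ v, dSum G v * h v) / D with hc
  -- By symmetry of m, the right side sums to ∑ d h - c ∑ d, which is zero for this c.
  obtain ⟨x, hx⟩ := exists_laplacian_eq hconn
    (y := fun v => ∑ u, (mult G v u : ℝ) * h u - c * dSum G v) (by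
      rw [Finset.sum_sub_distrib, ← Finset.mul_sum, Finset.sum_comm, hc,
        div_mul_cancel₀ _ hD.ne', sub_eq_zero]
      refine Finset.sum_congr rfl fun u _ => ?_
      rw [← Finset.sum_mul, ← sum_mult_cast]
      simp only [mult_comm G _ u])
  -- The staying node moves with probability 1 - α, so dividing by it leaves x(v) minus its
  -- neighbour average.
  refine ⟨fun e => h e.1.2 + x e.1.1 / (1 - α), fun e => ?_⟩
  rw [sum_transitionMatrix_mul α e fun v u => h u + x v / (1 - α)]
  obtain ⟨⟨v, j⟩, -⟩ := e
  have hd : (dSum G v : ℝ) ≠ 0 := by exact_mod_cast (dSum_pos G hconn hE v).ne'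
  have hα' : 1 - α ≠ 0 := by linarith
  have hxv := congrFun hx v
  rw [laplacian_apply] at hxv
  have hsum : ∑ k, (mult G v k : ℝ) / dSum G v *
      (α * (h k + x v / (1 - α)) + (1 - α) * (h k + x k / (1 - α))) =
      (∑ k, (mult G v k : ℝ) * h k - ∑ k, (mult G v k : ℝ) * (x v - x k)
        + x v / (1 - α) * ∑ k, (mult G v k : ℝ)) / dSum G v := by
    rw [Finset.mul_sum, ← Finset.sum_sub_distrib, ← Finset.sum_add_distrib, Finset.sum_div]
    refine Finset.sum_congr rfl fun k _ => ?_
    field_simp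
    ring
  simp only at hxv ⊢
  rw [hsum, hxv, sum_mult_cast]
  field_simp
  ring

end NeighbourSampling

open NeighbourSampling in
theorem theorem6 {V : Type*} [Fintype V] (G : Digraph V)
    (hconn : G.toSimpleGraphInclusive.Connected) (hE : ∃ u v, G.Adj u v)
    (α : ℝ) (hα0 : 0 ≤ α) (hα1 : α < 1) (f : V → ℝ)
    {Ω : Type*} [MeasurableSpace Ω] (μ : Measure Ω) [IsProbabilityMeasure μ]
    (Z : ℕ → Ω → State G) (hZ : IsMarkovChain μ (transitionMatrix G α) Z) :
    ∀ᵐ ω ∂μ, Tendsto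
      (fun t : ℕ =>
        (∑ s ∈ Finset.range t, weight G (Z s ω) * feature G f (Z s ω)) /
          ∑ s ∈ Finset.range t, weight G (Z s ω))
      atTop (𝓝 (uniformAverage f)) := by
  classical
  have := hconn.nonempty
  have hd : ∀ v, dSum G v ≠ 0 := fun v => (dSum_pos G hconn hE v).ne'
  have hd' : ∀ v, (dSum G v : ℝ) ≠ 0 := fun v => by exact_mod_cast hd v
  have hD := sum_dSum_pos hconn hE
  have hslln : ∀ h : V → ℝ, ∀ᵐ ω ∂μ, Tendsto
      (fun t : ℕ => (∑ s ∈ Finset.range t, h (Z s ω).1.2) / t) atTop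
      (𝓝 ((∑ v, dSum G v * h v) / ∑ v, (dSum G v : ℝ))) := fun h => by
    obtain ⟨φ, hφ⟩ := exists_poisson_solution hconn hE hα1 h
    exact hZ.ae_tendsto_average (g := fun e => h e.1.2)
      (fun e => sum_transitionMatrix α e (hd _)) hφ
  filter_upwards [hslln fun v => 1 / dSum G v * f v, hslln fun v => 1 / dSum G v]
    with ω hnum hden
  have hcancel : ∀ v, (dSum G v : ℝ) * (1 / dSum G v) = 1 := fun v => mul_one_div_cancel (hd' v)
  simp only [← mul_assoc, hcancel, one_mul, Finset.sum_const, Finset.card_univ, nsmul_eq_mul,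
    mul_one] at hnum hden
  have hcard : (Fintype.card V : ℝ) ≠ 0 := by exact_mod_cast Fintype.card_ne_zero
  have hlim := hnum.div hden (div_ne_zero hcard hD.ne')
  rw [div_div_div_cancel_right₀ hD.ne'] at hlim
  rw [uniformAverage, one_div_mul_eq_div]
  refine hlim.congr' ?_
  filter_upwards [eventually_ge_atTop 1] with t ht
  have ht' : (t : ℝ) ≠ 0 := by positivity
  exact div_div_div_cancel_right₀ ht' _ _
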